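/- Let $X_1,\dots,X_n$ be independent real random variables on a probability space, each having a probability density $f_j$ with respect to Lebesgue measure and such that its differential entropy $h(X_j)=-\int f_j\log f_j$ exists in $[-\infty,+\infty]$ (that is, the positive and negative parts of $-f_j\log f_j$ do not both have infinite integral). Write $X=(X_1,\dots,X_n)^t$; the differential entropy $h$ of a random vector in $\mathbb R^m$ is defined in the same way from its density on $\mathbb R^m$. Conventions: $0\cdot(\pm\infty)=0$, and a sum containing both $+\infty$ and $-\infty$ is read as $-\infty$ (so that the inequalities below say nothing in that case). (1) Let $A=(a_{i,j})$ be a real $m\times n$ matrix with orthonormal rows, $AA^t=I_m$. Then $AX$ has a probability density on $\mathbb R^m$. If $h(X_j)\neq-\infty$ for every $j$ whose column in $A$ is nonzero, then $h(AX)$ exists in $[-\infty,+\infty]$. Whenever $h(AX)$ exists, $$h(AX)\ \ge\ \sum_{i,j} a_{i,j}^2\,h(X_j).$$ (2) In particular, let $a_1,\dots,a_n\in\mathbb R$ with $\sum_i a_i^2=1$. Then $\sum_i a_iX_i$ has a probability density on $\mathbb R$. If $h(X_i)\neq-\infty$ for every $i$ with $a_i\ne0$, then $h\bigl(\sum_i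 a_iX_i\bigr)$ exists in $[-\infty,+\infty]$. Whenever it exists, $$h\Bigl(\sum_i a_iX_i\Bigr)\ \ge\ \sum_i a_i^2\,h(X_i).$$ -/

import Mathlib

open MeasureTheory ProbabilityTheory
open scoped ENNReal

/-- The integral of the positive part of `-f log f`, where `f` is the probability density of the
random vector `X` with respect to Lebesgue measure. -/
noncomputable def entropyPosPart {Ω E : Type*} [MeasurableSpace Ω] [MeasureSpace E]
    (X : Ω → E) (P : Measure Ω) : ℝ≥0∞ :=
  ∫⁻ x, ENNReal.ofReal (Real.negMulLog (pdf X P volume x).toReal)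

/-- The integral of the negative part of `-f log f`, where `f` is the probability density of the
random vector `X` with respect to Lebesgue measure. -/
noncomputable def entropyNegPart {Ω E : Type*} [MeasurableSpace Ω] [MeasureSpace E]
    (X : Ω → E) (P : Measure Ω) : ℝ≥0∞ :=
  ∫⁻ x, ENNReal.ofReal (-Real.negMulLog (pdf X P volume x).toReal)

/-- `X` has a probability density `f` with respect to Lebesgue measure, and the differential
entropy `-∫ f log f` exists in `[-∞, +∞]`: the positive and the negative part of `-f log f` do not
both have an infinite integral. -/
def HasDiffEntropy {Ω E : Type*} [MeasurableSpace Ω] [MeasureSpace E]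
    (X : Ω → E) (P : Measure Ω) : Prop :=
  HasPDF X P volume ∧ (entropyPosPart X P ≠ ⊤ ∨ entropyNegPart X P ≠ ⊤)

/-- The differential entropy `h(X) = -∫ f log f` in `[-∞, +∞]` (natural logarithm), meaningful
when `HasDiffEntropy X P` holds. -/
noncomputable def diffEntropy {Ω E : Type*} [MeasurableSpace Ω] [MeasureSpace E]
    (X : Ω → E) (P : Measure Ω) : EReal :=
  (entropyPosPart X P : EReal) - (entropyNegPart X P : EReal)

/-! The proof is by transport from Gaussians. Let `T j` be the increasing map carrying the standard
Gaussian to the law of `X j`, so that `AX` has the law of `Θ(Z) = A T(Z)` with `Z` standard Gaussian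
on `ℝⁿ`. Since `AAᵗ = 1`, `Z` has the law of `Aᵗu + w`, with `u` standard Gaussian on `ℝᵐ` and `w`
an independent Gaussian in the kernel of `A`. For fixed `w`, the map `u ↦ A T(Aᵗu + w)` is injective
with Jacobian matrix `A diag(T') Aᵗ`. Changing variables and averaging over `w` gives `E[g(Θ(Z))
det(A diag(T'(Z)) Aᵗ) / φ(AZ)] ≤ ∫ g` for every measurable `g ≥ 0`, where `φ` is the Gaussian
density (`lintegral_gaussian_det_div_le`).

For `g` the indicator of a null set, this gives the density of `AX`. For `g` that density, the right
side is 1. Concavity of the logarithm bounds `log det(A diag(T') Aᵗ)` below by `∑ a_ij² log T_j'`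
(`Matrix.sum_sq_mul_log_le_log_det`), and the Jacobian equation `f_j(T_j) T_j' = φ` turns `log T_j'`
into `log φ - log f_j(T_j)`. The Gaussian terms have total mean zero, so Jensen's inequality for
`exp` gives `-h(AX) ≤ -∑ a_ij² h(X_j)`. The same pointwise bounds supply the integrability when
entropies may be infinite. -/

/-! ### Concavity of the log-determinant. -/

theorem Matrix.sum_sq_row_of_mul_transpose_eq_one {m n : Type*} [Fintype n] [DecidableEq m]
    {A : Matrix m n ℝ} (hA : A * A.transpose = 1) (i : m) : ∑ j, A i j ^ 2 = 1 := by
  have := congrFun (congrFun hA i) i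
  simpa [Matrix.mul_apply, sq] using this

/-- Concavity of `log det` along matrices with orthonormal rows. -/
theorem Matrix.sum_sq_mul_log_le_log_det {m n : Type*} [Fintype m] [Fintype n] [DecidableEq m]
    [DecidableEq n] {A : Matrix m n ℝ} (hA : A * A.transpose = 1) {d : n → ℝ}
    (hd : ∀ j, 0 < d j) :
    0 < (A * Matrix.diagonal d * A.transpose).det ∧
    ∑ i, ∑ j, A i j ^ 2 * Real.log (d j) ≤
      Real.log (A * Matrix.diagonal d * A.transpose).det := by
  set M := A * Matrix.diagonal d * A.transpose with hMdef
  have hM : M.IsHermitian := by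
    rw [Matrix.IsHermitian, Matrix.conjTranspose_eq_transpose_of_trivial, hMdef]
    simp [Matrix.transpose_mul, Matrix.mul_assoc]
  set U : Matrix m m ℝ := hM.eigenvectorUnitary.1 with hU
  have hUU : U.transpose * U = 1 := by
    have := (Unitary.mem_iff.1 hM.eigenvectorUnitary.2).1
    rwa [Matrix.star_eq_conjTranspose, Matrix.conjTranspose_eq_transpose_of_trivial] at this
  have hUU' : U * U.transpose = 1 := by
    have := (Unitary.mem_iff.1 hM.eigenvectorUnitary.2).2
    rwa [Matrix.star_eq_conjTranspose, Matrix.conjTranspose_eq_transpose_of_trivial] at this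
  have hspec : M = U * Matrix.diagonal hM.eigenvalues * U.transpose := by
    have := hM.spectral_theorem
    simpa [Unitary.conjStarAlgAut_apply, Matrix.star_eq_conjTranspose,
      Matrix.conjTranspose_eq_transpose_of_trivial, Function.comp_def] using this
  -- Rotating the rows of `A` by the eigenbasis of `M` keeps them orthonormal and preserves the
  -- column norms, the only data of `A` on the left side. The eigenvalues become averages of `d`
  -- with weights `B i j ^ 2`, so Jensen applies row by row.
  set B := U.transpose * A with hB
  have hBB : B * B.transpose = 1 := by
    rw [hB, Matrix.transpose_mul, Matrix.transpose_transpose, Matrix.mul_assoc,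
      ← Matrix.mul_assoc A, hA, Matrix.one_mul, hUU]
  have hBtB : B.transpose * B = A.transpose * A := by
    rw [hB, Matrix.transpose_mul, Matrix.transpose_transpose, Matrix.mul_assoc,
      ← Matrix.mul_assoc U, hUU', Matrix.one_mul]
  have hBd : B * Matrix.diagonal d * B.transpose = Matrix.diagonal hM.eigenvalues := by
    calc B * Matrix.diagonal d * B.transpose = U.transpose * M * U := by
          rw [hB, hMdef, Matrix.transpose_mul, Matrix.transpose_transpose]
          simp only [Matrix.mul_assoc]
      _ = (U.transpose * U) * Matrix.diagonal hM.eigenvalues * (U.transpose * U) := by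
          conv_lhs => rw [hspec]
          simp only [Matrix.mul_assoc]
      _ = _ := by rw [hUU, Matrix.one_mul, Matrix.mul_one]
  have heig : ∀ i, hM.eigenvalues i = ∑ j, B i j ^ 2 * d j := by
    intro i
    have h := congrFun (congrFun hBd i) i
    rw [Matrix.diagonal_apply_eq, Matrix.mul_apply] at h
    rw [← h]
    refine Finset.sum_congr rfl fun j _ => ?_
    rw [Matrix.mul_diagonal, Matrix.transpose_apply]; ring
  have hrow : ∀ i, ∑ j, B i j ^ 2 = 1 := Matrix.sum_sq_row_of_mul_transpose_eq_one hBB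
  have hcol : ∀ j, ∑ i, B i j ^ 2 = ∑ i, A i j ^ 2 := by
    intro j
    have h := congrFun (congrFun hBtB j) j
    simpa [Matrix.mul_apply, sq] using h
  have hpos : ∀ i, 0 < hM.eigenvalues i := by
    intro i
    rw [heig]
    refine (Finset.sum_nonneg fun j _ => by have := hd j; positivity).lt_of_ne fun h0 => ?_
    have hz := (Finset.sum_eq_zero_iff_of_nonneg
      (fun j _ => by have := hd j; positivity)).1 h0.symm
    have : ∑ j, B i j ^ 2 = 0 := Finset.sum_eq_zero fun j hj =>
      (mul_eq_zero.1 (hz j hj)).resolve_right (hd j).ne'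
    rw [hrow] at this
    exact one_ne_zero this
  have hdet : M.det = ∏ i, hM.eigenvalues i := by
    simpa using hM.det_eq_prod_eigenvalues
  rw [hdet]
  refine ⟨Finset.prod_pos fun i _ => hpos i, ?_⟩
  rw [Real.log_prod (fun i _ => (hpos i).ne')]
  calc ∑ i, ∑ j, A i j ^ 2 * Real.log (d j) = ∑ i, ∑ j, B i j ^ 2 * Real.log (d j) := by
        rw [Finset.sum_comm, Finset.sum_comm (f := fun i j => B i j ^ 2 * Real.log (d j))]
        refine Finset.sum_congr rfl fun j _ => ?_
        rw [← Finset.sum_mul, ← Finset.sum_mul, hcol]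
    _ ≤ _ := by
        refine Finset.sum_le_sum fun i _ => ?_
        rw [heig]
        have := strictConcaveOn_log_Ioi.concaveOn.le_map_sum (t := Finset.univ)
          (w := fun j => B i j ^ 2) (p := d) (fun j _ => sq_nonneg _) (hrow i) (fun j _ => hd j)
        simpa [smul_eq_mul] using this

/-! ### Monotone transport from the Gaussian on the line. -/

theorem ProbabilityTheory.continuous_cdf (μ : Measure ℝ) [IsProbabilityMeasure μ]
    [NullSingletonClass μ] : Continuous (cdf μ) := by
  have h : ∀ x, (cdf μ).measure {x} = 0 := fun x => by rw [measure_cdf]; simp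
  refine continuous_iff_continuousAt.2 fun x => ?_
  have h0 := h x
  rw [StieltjesFunction.measure_singleton, ENNReal.ofReal_eq_zero, sub_nonpos] at h0
  have hle : Function.leftLim (cdf μ) x = cdf μ x :=
    le_antisymm (monotone_cdf μ |>.leftLim_le le_rfl) h0
  refine continuousAt_iff_continuous_left'_right'.2 ⟨?_, ?_⟩
  · rw [(monotone_cdf μ).continuousWithinAt_Iio_iff_leftLim_eq]; exact hle
  · exact ((cdf μ).right_continuous x).mono Set.Ioi_subset_Ici_self

theorem ProbabilityTheory.exists_cdf_eq (μ : Measure ℝ) [IsProbabilityMeasure μ]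
    [NullSingletonClass μ] {p : ℝ} (h0 : 0 < p) (h1 : p < 1) : ∃ x, cdf μ x = p :=
  mem_range_of_exists_le_of_exists_ge (continuous_cdf μ)
    (((tendsto_cdf_atBot μ).eventually (Iio_mem_nhds h0)).exists.imp fun _ h => le_of_lt h)
    (((tendsto_cdf_atTop μ).eventually (Ioi_mem_nhds h1)).exists.imp fun _ h => le_of_lt h)

theorem ProbabilityTheory.strictMono_cdf_gaussianReal : StrictMono (cdf (gaussianReal 0 1)) := by
  intro x y hxy
  have h : 0 < gaussianReal 0 1 (Set.Ioc x y) := by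
    refine pos_iff_ne_zero.2 fun h => ?_
    have := gaussianReal_absolutelyContinuous' 0 (one_ne_zero) h
    simp [Real.volume_Ioc] at this
    linarith
  rw [← measure_cdf (gaussianReal 0 1), StieltjesFunction.measure_Ioc, ENNReal.ofReal_pos] at h
  linarith

theorem ProbabilityTheory.cdf_gaussianReal_mem_Ioo (x : ℝ) :
    cdf (gaussianReal 0 1) x ∈ Set.Ioo (0 : ℝ) 1 :=
  ⟨(cdf_nonneg _ (x - 1)).trans_lt (strictMono_cdf_gaussianReal (by linarith)),
    (strictMono_cdf_gaussianReal (show x < x + 1 by linarith)).trans_le (cdf_le_one _ _)⟩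

/-- Probability integral transform. The endpoints are separate because the Gaussian cdf attains
neither 0 nor 1. -/
theorem ProbabilityTheory.gaussianReal_cdf_le {p : ℝ} (h0 : 0 ≤ p) (h1 : p ≤ 1) :
    gaussianReal 0 1 {z | cdf (gaussianReal 0 1) z ≤ p} = ENNReal.ofReal p := by
  have : NullSingletonClass (gaussianReal 0 1) := nullSingletonClass_gaussianReal one_ne_zero
  rcases h0.eq_or_lt with rfl | h0
  · have : {z | cdf (gaussianReal 0 1) z ≤ 0} = ∅ := by
      ext z; simpa using (cdf_gaussianReal_mem_Ioo z).1
    simp [this]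
  rcases h1.eq_or_lt with rfl | h1
  · have : {z | cdf (gaussianReal 0 1) z ≤ 1} = Set.univ := by
      ext z; simpa using cdf_le_one _ z
    simp [this]
  obtain ⟨x, rfl⟩ := exists_cdf_eq (gaussianReal 0 1) h0 h1
  have : {z | cdf (gaussianReal 0 1) z ≤ cdf (gaussianReal 0 1) x} = Set.Iic x := by
    ext z; simp [strictMono_cdf_gaussianReal.le_iff_le]
  rw [this, ofReal_cdf]

theorem ProbabilityTheory.gaussianReal_cdf_lt {p : ℝ} (h0 : 0 ≤ p) (h1 : p ≤ 1) :
    gaussianReal 0 1 {z | cdf (gaussianReal 0 1) z < p} = ENNReal.ofReal p := by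
  have : NullSingletonClass (gaussianReal 0 1) := nullSingletonClass_gaussianReal one_ne_zero
  rw [← gaussianReal_cdf_le h0 h1]
  refine measure_congr ?_
  have hs : ({z | cdf (gaussianReal 0 1) z = p} : Set ℝ).Subsingleton := fun a ha b hb =>
    strictMono_cdf_gaussianReal.injective (ha.trans hb.symm)
  have h := hs.measure_zero (gaussianReal 0 1)
  filter_upwards [measure_eq_zero_iff_ae_notMem.1 h] with z hz
  exact propext ⟨fun h => le_of_lt h, fun h => lt_of_le_of_ne h hz⟩

/-- The increasing rearrangement of the standard Gaussian measure onto an absolutely continuous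
probability measure, with its almost everywhere Jacobian equation. -/
theorem ProbabilityTheory.exists_strictMono_map_gaussianReal (μ : Measure ℝ)
    [IsProbabilityMeasure μ] (hμ : μ ≪ volume) :
    ∃ T : ℝ → ℝ, StrictMono T ∧ (gaussianReal 0 1).map T = μ ∧
      ∀ᵐ z ∂(gaussianReal 0 1), DifferentiableAt ℝ T z ∧ 0 < deriv T z ∧
        0 < (μ.rnDeriv volume (T z)).toReal ∧
        (μ.rnDeriv volume (T z)).toReal * deriv T z = gaussianPDFReal 0 1 z := by
  have : NullSingletonClass μ := ⟨fun x => hμ (by simp)⟩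
  -- Any choice of preimage serves: on a flat stretch of `cdf μ` the choice is arbitrary, and strict
  -- monotonicity of the Gaussian cdf still makes `T` strictly increasing.
  have hex : ∀ z, ∃ x, cdf μ x = cdf (gaussianReal 0 1) z := fun z =>
    exists_cdf_eq μ (cdf_gaussianReal_mem_Ioo z).1 (cdf_gaussianReal_mem_Ioo z).2
  choose T hT using hex
  have hmono : StrictMono T := fun a b hab => (monotone_cdf μ).reflect_lt
    (by rw [hT, hT]; exact strictMono_cdf_gaussianReal hab)
  have hmeas : Measurable T := hmono.monotone.measurable
  have : IsProbabilityMeasure ((gaussianReal 0 1).map T) :=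
    Measure.isProbabilityMeasure_map hmeas.aemeasurable
  -- With `p = cdf μ x`, the preimage of `Iic x` lies between the sets where the Gaussian cdf is `<
  -- p` and `≤ p`, both of mass `p`.
  have hmap : (gaussianReal 0 1).map T = μ := by
    refine Measure.ext_of_Iic _ _ fun x => ?_
    rw [Measure.map_apply hmeas measurableSet_Iic]
    refine le_antisymm ?_ ?_
    · rw [← ofReal_cdf, ← gaussianReal_cdf_le (cdf_nonneg μ x) (cdf_le_one μ x)]
      refine measure_mono fun z hz => ?_
      rw [Set.mem_ofPred_eq, ← hT]
      exact monotone_cdf μ hz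
    · rw [← ofReal_cdf, ← gaussianReal_cdf_lt (cdf_nonneg μ x) (cdf_le_one μ x)]
      refine measure_mono fun z hz => ?_
      rw [Set.mem_ofPred_eq, ← hT] at hz
      exact ((monotone_cdf μ).reflect_lt hz).le
  refine ⟨T, hmono, hmap, ?_⟩
  have hγ : gaussianReal 0 1 ≪ volume := gaussianReal_absolutelyContinuous 0 one_ne_zero
  have h1 : ∀ᵐ z ∂(gaussianReal 0 1), DifferentiableAt ℝ T z :=
    hγ.ae_le hmono.monotone.ae_differentiableAt
  have h2 : ∀ᵐ z ∂(gaussianReal 0 1),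
      HasDerivAt (cdf μ) ((μ.rnDeriv volume (T z)).toReal) (T z) := by
    have := (cdf μ).ae_hasDerivAt
    rw [measure_cdf] at this
    have h' := hμ.ae_le this
    rw [← hmap] at h'
    have h'' := ae_of_ae_map hmeas.aemeasurable h'
    rwa [hmap] at h''
  have h3 : ∀ᵐ z ∂(gaussianReal 0 1),
      HasDerivAt (cdf (gaussianReal 0 1)) (gaussianPDFReal 0 1 z) z := by
    have := (cdf (gaussianReal 0 1)).ae_hasDerivAt
    rw [measure_cdf] at this
    filter_upwards [hγ.ae_le this, hγ.ae_le (rnDeriv_gaussianReal 0 1)] with z hz hz'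
    rwa [hz', toReal_gaussianPDF] at hz
  filter_upwards [h1, h2, h3] with z hz1 hz2 hz3
  -- Differentiating `cdf μ ∘ T = cdf (gaussianReal 0 1)` pointwise yields the Jacobian equation
  -- without any absolute continuity of `T`.
  have hcomp : HasDerivAt (cdf (gaussianReal 0 1))
      ((μ.rnDeriv volume (T z)).toReal * deriv T z) z := by
    have := hz2.comp z hz1.hasDerivAt
    rwa [show (cdf μ ∘ T : ℝ → ℝ) = cdf (gaussianReal 0 1) from funext hT] at this
  have heq := hcomp.unique hz3
  have hpos : 0 < (μ.rnDeriv volume (T z)).toReal * deriv T z := by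
    rw [heq]; exact gaussianPDFReal_pos 0 1 z one_ne_zero
  have hd : 0 < deriv T z := lt_of_le_of_ne hmono.monotone.deriv_nonneg fun h => by
    simp [← h] at hpos
  exact ⟨hz1, hd, pos_of_mul_pos_left hpos hd.le, heq⟩

/-! ### The standard Gaussian measure in several dimensions. -/

theorem ProbabilityTheory.integral_exp_pi_gaussianReal {ι : Type*} [Fintype ι] (t : ι → ℝ) :
    ∫ x, Complex.exp (((∑ i, x i * t i : ℝ) : ℂ) * Complex.I)
      ∂(Measure.pi fun _ : ι => gaussianReal 0 1) =
      Complex.exp (((-(∑ i, t i ^ 2) / 2 : ℝ) : ℂ)) := by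
  have h := charFun_stdGaussian (WithLp.toLp 2 t : EuclideanSpace ℝ ι)
  rw [← map_pi_eq_stdGaussian, charFun_apply, integral_map (by fun_prop) (by fun_prop),
    ← Complex.ofReal_pow, EuclideanSpace.real_norm_sq_eq] at h
  simpa [PiLp.inner_apply, mul_comm] using h

/-- Orthogonal decomposition of the standard Gaussian measure along the rows of `A`. -/
theorem ProbabilityTheory.map_prod_pi_gaussianReal {m n : Type*} [Fintype m] [Fintype n]
    [DecidableEq m] {A : Matrix m n ℝ} (hA : A * A.transpose = 1) :
    ((Measure.pi fun _ : m => gaussianReal 0 1).prod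
      (Measure.pi fun _ : n => gaussianReal 0 1)).map
      (fun p => A.transpose.mulVec p.1 + (p.2 - A.transpose.mulVec (A.mulVec p.2))) =
      Measure.pi fun _ : n => gaussianReal 0 1 := by
  set R : (m → ℝ) × (n → ℝ) → (n → ℝ) :=
    fun p => A.transpose.mulVec p.1 + (p.2 - A.transpose.mulVec (A.mulVec p.2)) with hR
  have hRm : Measurable R := by
    refine Continuous.measurable ?_
    fun_prop
  apply (MeasurableEquiv.toLp 2 (n → ℝ)).map_measurableEquiv_injective
  refine Measure.ext_of_charFun (E := EuclideanSpace ℝ n) ?_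
  ext t
  have hcont : Continuous fun x : n → ℝ =>
      Complex.exp (((∑ i, x i * t i : ℝ) : ℂ) * Complex.I) := by fun_prop
  have hchar : ∀ ν : Measure (n → ℝ), charFun (ν.map (MeasurableEquiv.toLp 2 (n → ℝ))) t =
      ∫ x, Complex.exp (((∑ i, x i * t i : ℝ) : ℂ) * Complex.I) ∂ν := by
    intro ν
    rw [charFun_apply, integral_map (by fun_prop) (by fun_prop)]
    simp [PiLp.inner_apply, mul_comm]
  rw [hchar, hchar, integral_exp_pi_gaussianReal,
    integral_map hRm.aemeasurable hcont.aestronglyMeasurable]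
  set s : n → ℝ := fun i => t i with hs
  have hT : ∀ u : m → ℝ, ∀ v : n → ℝ, A.transpose.mulVec u ⬝ᵥ v = u ⬝ᵥ A.mulVec v :=
    fun u v => by rw [Matrix.mulVec_transpose, Matrix.dotProduct_mulVec]
  have hAA : ∀ u : m → ℝ, A.mulVec (A.transpose.mulVec u) = u := fun u => by
    rw [Matrix.mulVec_mulVec, hA, Matrix.one_mulVec]
  -- Moving `A` and the symmetric projection `1 - AᵗA` onto the frequency `s` factors the
  -- characteristic function; Pythagoras, `|As|² + |s - AᵗAs|² = |s|²`, then recombines the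
  -- exponents.
  have hsplit : ∀ p : (m → ℝ) × (n → ℝ), Complex.exp (((∑ i, R p i * t i : ℝ) : ℂ) * Complex.I) =
      Complex.exp (((∑ i, p.1 i * (A.mulVec s) i : ℝ) : ℂ) * Complex.I) *
      Complex.exp (((∑ i, p.2 i * (s - A.transpose.mulVec (A.mulVec s)) i : ℝ) : ℂ) *
        Complex.I) := by
    intro p
    rw [← Complex.exp_add, ← add_mul, ← Complex.ofReal_add]
    congr 3
    change R p ⬝ᵥ s = p.1 ⬝ᵥ A.mulVec s + p.2 ⬝ᵥ (s - A.transpose.mulVec (A.mulVec s))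
    rw [hR]
    simp only [add_dotProduct, sub_dotProduct, dotProduct_sub, hT]
    rw [dotProduct_comm p.2 (A.transpose.mulVec _), hT, dotProduct_comm (A.mulVec s)]
  simp_rw [hsplit]
  rw [integral_prod_mul (fun u : m → ℝ => Complex.exp (((∑ i, u i * (A.mulVec s) i : ℝ) : ℂ) *
      Complex.I)) (fun z : n → ℝ => Complex.exp (((∑ i, z i *
      (s - A.transpose.mulVec (A.mulVec s)) i : ℝ) : ℂ) * Complex.I)),
    integral_exp_pi_gaussianReal, integral_exp_pi_gaussianReal, ← Complex.exp_add,
    ← Complex.ofReal_add]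
  congr 2
  have h1 : ∑ i, (A.mulVec s) i ^ 2 = A.mulVec s ⬝ᵥ A.mulVec s := by
    simp [dotProduct, sq]
  have h2 : ∑ i, (s - A.transpose.mulVec (A.mulVec s)) i ^ 2 =
      s ⬝ᵥ s - A.mulVec s ⬝ᵥ A.mulVec s := by
    have : ∑ i, (s - A.transpose.mulVec (A.mulVec s)) i ^ 2 =
      (s - A.transpose.mulVec (A.mulVec s)) ⬝ᵥ (s - A.transpose.mulVec (A.mulVec s)) := by
      simp only [dotProduct, sq]
    rw [this]
    simp only [sub_dotProduct, dotProduct_sub, hT, hAA]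
    rw [dotProduct_comm s (A.transpose.mulVec _), hT]
    ring
  rw [h1, h2, show ∑ i, t i ^ 2 = s ⬝ᵥ s by simp [dotProduct, sq, hs]]
  ring

theorem ProbabilityTheory.pi_gaussianReal_eq_withDensity (ι : Type*) [Fintype ι] :
    (Measure.pi fun _ : ι => gaussianReal 0 1) =
      volume.withDensity fun x => ENNReal.ofReal (∏ i, gaussianPDFReal 0 1 (x i)) := by
  refine Measure.pi_eq fun s hs => ?_
  rw [withDensity_apply _ (MeasurableSet.univ_pi hs), volume_pi, Measure.restrict_pi_pi,
    ← ofReal_integral_eq_lintegral_ofReal, integral_fintype_prod_eq_prod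
      (fun _ x => gaussianPDFReal 0 1 x), ENNReal.ofReal_prod_of_nonneg]
  · refine Finset.prod_congr rfl fun i _ => ?_
    rw [gaussianReal_apply_eq_integral 0 one_ne_zero]
  · exact fun i _ => integral_nonneg fun x => gaussianPDFReal_nonneg 0 1 x
  · exact Integrable.fintype_prod (f := fun _ x => gaussianPDFReal 0 1 x)
      fun i => (integrable_gaussianPDFReal 0 1).restrict
  · exact .of_forall fun x => Finset.prod_nonneg fun i _ => gaussianPDFReal_nonneg 0 1 (x i)

theorem ProbabilityTheory.integrable_log_gaussianPDFReal :
    Integrable (fun z => Real.log (gaussianPDFReal 0 1 z)) (gaussianReal 0 1) := by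
  have h : (fun z => Real.log (gaussianPDFReal 0 1 z)) =
      fun z => Real.log ((√(2 * Real.pi * 1))⁻¹) + -(1 / 2) * z ^ 2 := by
    ext z
    rw [gaussianPDFReal_def]
    dsimp only
    rw [Real.log_mul (by positivity) (Real.exp_pos _).ne', Real.log_exp]
    simp
    ring
  rw [h]
  have : MemLp (id : ℝ → ℝ) 2 (gaussianReal 0 1) := IsGaussian.memLp_two_id
  exact (integrable_const _).add (this.integrable_sq.const_mul _)

/-! ### Change of variables along the rows of `A`. -/

theorem Matrix.hasFDerivAt_mulVec_comp {m n : Type*} [Fintype m] [Fintype n] [DecidableEq m]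
    [DecidableEq n] (A : Matrix m n ℝ) {T : n → ℝ → ℝ} (w : n → ℝ) {u : m → ℝ}
    (h : ∀ j, DifferentiableAt ℝ (T j) ((A.transpose.mulVec u + w) j)) :
    HasFDerivAt (fun u : m → ℝ => A.mulVec fun j => T j ((A.transpose.mulVec u + w) j))
      (Matrix.toLin' (A * Matrix.diagonal
        (fun j => deriv (T j) ((A.transpose.mulVec u + w) j)) * A.transpose)).toContinuousLinearMap
      u := by
  have h1 : HasFDerivAt (fun u : m → ℝ => A.transpose.mulVec u + w)
      (Matrix.toLin' A.transpose).toContinuousLinearMap u :=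
    ((Matrix.toLin' A.transpose).toContinuousLinearMap.hasFDerivAt).add_const w
  have h2 : HasFDerivAt (fun z : n → ℝ => fun j => T j (z j))
      (Matrix.toLin' (Matrix.diagonal
        (fun j => deriv (T j) ((A.transpose.mulVec u + w) j)))).toContinuousLinearMap
      (A.transpose.mulVec u + w) := by
    rw [hasFDerivAt_pi']
    intro j
    have := ((h j).hasDerivAt.hasFDerivAt).comp (A.transpose.mulVec u + w)
      (ContinuousLinearMap.proj (R := ℝ) (φ := fun _ : n => ℝ) j).hasFDerivAt
    refine this.congr_fderiv ?_
    ext x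
    simp [Matrix.mulVec_diagonal, mul_comm]
  have h3 := ((Matrix.toLin' A).toContinuousLinearMap.hasFDerivAt
    (x := fun j => T j ((A.transpose.mulVec u + w) j))).comp u (h2.comp u h1)
  refine h3.congr_fderiv ?_
  ext x
  simp [Matrix.mulVec_mulVec, Matrix.mul_assoc]

/-- Strict monotonicity: with `a = Aᵗu + w` and `b = Aᵗv + w`, pairing `u - v` with the difference
of the images gives `∑ (a_j - b_j)(T_j a_j - T_j b_j)`. If it vanishes, every nonnegative term does,
so `a = b`, and applying `A` gives `u = v`. -/
theorem Matrix.injective_mulVec_comp {m n : Type*} [Fintype m] [Fintype n] [DecidableEq m]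
    {A : Matrix m n ℝ} (hA : A * A.transpose = 1) {T : n → ℝ → ℝ} (hT : ∀ j, StrictMono (T j))
    (w : n → ℝ) :
    Function.Injective fun u : m → ℝ => A.mulVec fun j => T j ((A.transpose.mulVec u + w) j) := by
  intro u v huv
  set a := A.transpose.mulVec u + w with ha
  set b := A.transpose.mulVec v + w with hb
  have hzero : (u - v) ⬝ᵥ A.mulVec ((fun j => T j (a j)) - fun j => T j (b j)) = 0 := by
    rw [Matrix.mulVec_sub, show A.mulVec (fun j => T j (a j)) = A.mulVec (fun j => T j (b j))
      from huv, sub_self, dotProduct_zero]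
  rw [Matrix.dotProduct_mulVec, ← Matrix.mulVec_transpose, Matrix.mulVec_sub,
    show A.transpose.mulVec u - A.transpose.mulVec v = a - b by rw [ha, hb]; abel] at hzero
  have hterm : ∀ j ∈ Finset.univ, 0 ≤ (a - b) j * ((fun j => T j (a j)) - fun j => T j (b j)) j := by
    intro j _
    simp only [Pi.sub_apply]
    rcases le_total (a j) (b j) with h | h
    · exact mul_nonneg_of_nonpos_of_nonpos (sub_nonpos.2 h)
        (sub_nonpos.2 ((hT j).monotone h))
    · exact mul_nonneg (sub_nonneg.2 h) (sub_nonneg.2 ((hT j).monotone h))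
  have hab : a = b := by
    ext j
    have := (Finset.sum_eq_zero_iff_of_nonneg hterm).1 hzero j (Finset.mem_univ j)
    simp only [Pi.sub_apply, mul_eq_zero, sub_eq_zero] at this
    exact this.elim id fun h => (hT j).injective h
  have hAA : ∀ u : m → ℝ, A.mulVec (A.transpose.mulVec u) = u := fun u => by
    rw [Matrix.mulVec_mulVec, hA, Matrix.one_mulVec]
  rw [← hAA u, ← hAA v]
  congr 1
  exact add_right_cancel hab

/-- Only an inequality, since the image of the differentiability set need not fill `ℝᵐ`; this
suffices for an upper bound. -/
theorem Matrix.lintegral_mulVec_comp_mul_det_le {m n : Type*} [Fintype m] [Fintype n]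
    [DecidableEq m] [DecidableEq n] {A : Matrix m n ℝ} (hA : A * A.transpose = 1)
    {T : n → ℝ → ℝ} (hT : ∀ j, StrictMono (T j)) (w : n → ℝ) (g : (m → ℝ) → ℝ≥0∞) :
    ∫⁻ u in {u | ∀ j, DifferentiableAt ℝ (T j) ((A.transpose.mulVec u + w) j)},
      ENNReal.ofReal |(A * Matrix.diagonal (fun j => deriv (T j)
        ((A.transpose.mulVec u + w) j)) * A.transpose).det| *
        g (A.mulVec fun j => T j ((A.transpose.mulVec u + w) j)) ≤ ∫⁻ y, g y := by
  set S := {u : m → ℝ | ∀ j, DifferentiableAt ℝ (T j) ((A.transpose.mulVec u + w) j)} with hS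
  have hSm : MeasurableSet S := by
    have : S = ⋂ j, (fun u : m → ℝ => (A.transpose.mulVec u + w) j) ⁻¹'
        {x | DifferentiableAt ℝ (T j) x} := by
      ext u; simp [hS]
    rw [this]
    refine MeasurableSet.iInter fun j => (measurableSet_of_differentiableAt ℝ (T j)).preimage ?_
    exact Continuous.measurable (by fun_prop)
  have h := lintegral_image_eq_lintegral_abs_det_fderiv_mul volume hSm
    (fun u hu => (Matrix.hasFDerivAt_mulVec_comp A w hu).hasFDerivWithinAt)
    (Matrix.injective_mulVec_comp hA hT w).injOn g
  have hdet : ∀ M : Matrix m m ℝ,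
      ((Matrix.toLin' M).toContinuousLinearMap).det = M.det := fun M => by
    rw [ContinuousLinearMap.det, LinearMap.coe_toContinuousLinearMap, LinearMap.det_toLin']
  simp only [hdet] at h
  rw [← h]
  exact setLIntegral_le_lintegral _ _

theorem ProbabilityTheory.measurable_det_diagonal_deriv_div {m n : Type*} [Fintype m] [Fintype n]
    [DecidableEq m] [DecidableEq n] (A : Matrix m n ℝ) (T : n → ℝ → ℝ) :
    Measurable fun z : n → ℝ => ENNReal.ofReal
      (|(A * Matrix.diagonal (fun j => deriv (T j) (z j)) * A.transpose).det| /
        ∏ i, gaussianPDFReal 0 1 (A.mulVec z i)) := by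
  have hdetm : Measurable fun z : n → ℝ =>
      (A * Matrix.diagonal (fun j => deriv (T j) (z j)) * A.transpose).det :=
    (Continuous.measurable (f := fun x : n → ℝ => (A * Matrix.diagonal x * A.transpose).det)
      (by fun_prop)).comp
      (measurable_pi_lambda _ fun j => (measurable_deriv (T j)).comp (measurable_pi_apply j))
  have hφm : Measurable fun z : n → ℝ => ∏ i, gaussianPDFReal 0 1 (A.mulVec z i) :=
    Finset.measurable_prod _ fun i _ => (measurable_gaussianPDFReal 0 1).comp
      (Continuous.measurable (by fun_prop))
  exact (hdetm.abs.div hφm).ennreal_ofReal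

/-- Change of variables for the conditional transport `u ↦ A T(Aᵀ u + w)`, averaged over the
standard Gaussian measure. -/
theorem ProbabilityTheory.lintegral_gaussian_det_div_le {m n : Type*} [Fintype m] [Fintype n]
    [DecidableEq m] [DecidableEq n] {A : Matrix m n ℝ} (hA : A * A.transpose = 1)
    {T : n → ℝ → ℝ} (hT : ∀ j, StrictMono (T j))
    (hd : ∀ j, ∀ᵐ z ∂(gaussianReal 0 1), DifferentiableAt ℝ (T j) z)
    {g : (m → ℝ) → ℝ≥0∞} (hg : Measurable g) :
    ∫⁻ z, g (A.mulVec fun j => T j (z j)) * ENNReal.ofReal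
      (|(A * Matrix.diagonal (fun j => deriv (T j) (z j)) * A.transpose).det| /
        ∏ i, gaussianPDFReal 0 1 (A.mulVec z i)) ∂(Measure.pi fun _ : n => gaussianReal 0 1) ≤
      ∫⁻ y, g y := by
  set S : Set (n → ℝ) := {z | ∀ j, DifferentiableAt ℝ (T j) (z j)} with hS
  have hSm : MeasurableSet S := by
    have : S = ⋂ j, (fun z : n → ℝ => z j) ⁻¹' {x | DifferentiableAt ℝ (T j) x} := by
      ext u; simp [hS]
    rw [this]
    exact MeasurableSet.iInter fun j =>
      (measurableSet_of_differentiableAt ℝ (T j)).preimage (measurable_pi_apply j)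
  have hSae : ∀ᵐ z ∂(Measure.pi fun _ : n => gaussianReal 0 1), z ∈ S := by
    rw [hS]
    refine ae_all_iff.2 fun j => ?_
    exact (Measure.quasiMeasurePreserving_eval (fun _ : n => gaussianReal 0 1) j).ae (hd j)
  set H : (n → ℝ) → ℝ≥0∞ := fun z => g (A.mulVec fun j => T j (z j)) * ENNReal.ofReal
      (|(A * Matrix.diagonal (fun j => deriv (T j) (z j)) * A.transpose).det| /
        ∏ i, gaussianPDFReal 0 1 (A.mulVec z i)) with hH
  have hTm : Measurable fun z : n → ℝ => A.mulVec fun j => T j (z j) :=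
    (Continuous.measurable (f := fun x : n → ℝ => A.mulVec x) (by fun_prop)).comp
      (measurable_pi_lambda _ fun j => (hT j).monotone.measurable.comp (measurable_pi_apply j))
  have hHm : Measurable H :=
    (hg.comp hTm).mul (measurable_det_diagonal_deriv_div A T)
  have hHS : Measurable (S.indicator H) := hHm.indicator hSm
  have hRm : Measurable fun p : (m → ℝ) × (n → ℝ) =>
      A.transpose.mulVec p.1 + (p.2 - A.transpose.mulVec (A.mulVec p.2)) :=
    Continuous.measurable (by fun_prop)
  calc ∫⁻ z, H z ∂(Measure.pi fun _ : n => gaussianReal 0 1)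
      = ∫⁻ z, S.indicator H z ∂(Measure.pi fun _ : n => gaussianReal 0 1) := by
        refine lintegral_congr_ae ?_
        filter_upwards [hSae] with z hz
        rw [Set.indicator_of_mem hz]
    _ = ∫⁻ z', ∫⁻ u, S.indicator H (A.transpose.mulVec u +
          (z' - A.transpose.mulVec (A.mulVec z'))) ∂(Measure.pi fun _ : m => gaussianReal 0 1)
          ∂(Measure.pi fun _ : n => gaussianReal 0 1) := by
        conv_lhs => rw [← map_prod_pi_gaussianReal hA]
        have hcomp : Measurable fun p : (m → ℝ) × (n → ℝ) => S.indicator H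
            (A.transpose.mulVec p.1 + (p.2 - A.transpose.mulVec (A.mulVec p.2))) := hHS.comp hRm
        rw [lintegral_map hHS hRm, lintegral_prod_symm _ hcomp.aemeasurable]
    -- For fixed `w`, `Aw = 0`, so the denominator is the Gaussian density at `u` itself: it cancels
    -- the density of the inner measure and leaves a Lebesgue integral.
    _ ≤ ∫⁻ _z', (∫⁻ y, g y) ∂(Measure.pi fun _ : n => gaussianReal 0 1) := by
        refine lintegral_mono fun z' => ?_
        set w := z' - A.transpose.mulVec (A.mulVec z') with hw
        have hAw : ∀ u, A.mulVec (A.transpose.mulVec u + w) = u := fun u => by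
          rw [hw, Matrix.mulVec_add, Matrix.mulVec_sub, Matrix.mulVec_mulVec, hA,
            Matrix.mulVec_mulVec, hA, Matrix.one_mulVec, Matrix.one_mulVec, sub_self, add_zero]
        refine le_trans (le_of_eq ?_) (Matrix.lintegral_mulVec_comp_mul_det_le hA hT w g)
        have hφ : Measurable fun x : m → ℝ => ENNReal.ofReal (∏ i, gaussianPDFReal 0 1 (x i)) :=
          Measurable.ennreal_ofReal (Finset.measurable_prod _ fun i _ =>
            (measurable_gaussianPDFReal 0 1).comp (measurable_pi_apply i))
        have hcomp : Measurable fun u : m → ℝ => S.indicator H (A.transpose.mulVec u + w) :=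
          hHS.comp (Continuous.measurable (by fun_prop))
        rw [pi_gaussianReal_eq_withDensity, lintegral_withDensity_eq_lintegral_mul _ hφ hcomp,
          ← lintegral_indicator]
        · refine lintegral_congr fun u => ?_
          by_cases hu : A.transpose.mulVec u + w ∈ S
          · have hpos : 0 < ∏ i, gaussianPDFReal 0 1 (u i) :=
              Finset.prod_pos fun i _ => gaussianPDFReal_pos 0 1 _ one_ne_zero
            rw [Set.indicator_of_mem (show u ∈ {u | ∀ j, DifferentiableAt ℝ (T j)
              ((A.transpose.mulVec u + w) j)} from hu), Pi.mul_apply, Set.indicator_of_mem hu, hH]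
            simp only [hAw]
            rw [mul_left_comm, ← ENNReal.ofReal_mul hpos.le, mul_div_cancel₀ _ hpos.ne', mul_comm]
          · rw [Set.indicator_of_notMem (show u ∉ {u | ∀ j, DifferentiableAt ℝ (T j)
              ((A.transpose.mulVec u + w) j)} from hu), Pi.mul_apply, Set.indicator_of_notMem hu,
              mul_zero]
        · exact hSm.preimage (f := fun u : m → ℝ => A.transpose.mulVec u + w)
            (Continuous.measurable (by fun_prop))
    _ = ∫⁻ y, g y := by simp

/-! ### Entropy as an expected log-density, and its invariance. -/

theorem entropyPosPart_eq_lintegral_map {Ω E : Type*} [MeasurableSpace Ω] [MeasureSpace E]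
    {X : Ω → E} {P : Measure Ω} [IsFiniteMeasure P] [HasPDF X P volume] :
    entropyPosPart X P =
      ∫⁻ y, ENNReal.ofReal (-Real.log (pdf X P volume y).toReal) ∂(P.map X) := by
  have hm := measurable_pdf X P volume
  rw [map_eq_withDensity_pdf X P volume,
    lintegral_withDensity_eq_lintegral_mul _ hm (by fun_prop), entropyPosPart]
  refine lintegral_congr_ae ?_
  have h : (fun y => ENNReal.ofReal (pdf X P volume y).toReal) =ᵐ[volume] pdf X P volume :=
    pdf.ofReal_toReal_ae_eq
  filter_upwards [h] with y hy
  rw [Pi.mul_apply]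
  nth_rw 2 [← hy]
  rw [← ENNReal.ofReal_mul ENNReal.toReal_nonneg, Real.negMulLog, neg_mul, mul_neg]

theorem entropyNegPart_eq_lintegral_map {Ω E : Type*} [MeasurableSpace Ω] [MeasureSpace E]
    {X : Ω → E} {P : Measure Ω} [IsFiniteMeasure P] [HasPDF X P volume] :
    entropyNegPart X P =
      ∫⁻ y, ENNReal.ofReal (Real.log (pdf X P volume y).toReal) ∂(P.map X) := by
  have hm := measurable_pdf X P volume
  rw [map_eq_withDensity_pdf X P volume,
    lintegral_withDensity_eq_lintegral_mul _ hm (by fun_prop), entropyNegPart]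
  refine lintegral_congr_ae ?_
  have h : (fun y => ENNReal.ofReal (pdf X P volume y).toReal) =ᵐ[volume] pdf X P volume :=
    pdf.ofReal_toReal_ae_eq
  filter_upwards [h] with y hy
  rw [Pi.mul_apply]
  nth_rw 2 [← hy]
  rw [← ENNReal.ofReal_mul ENNReal.toReal_nonneg, Real.negMulLog, neg_mul, neg_neg]

/-- Since `⊤ - ⊤ = ⊥` in `EReal`, an infinite negative part alone decides the value. -/
theorem diffEntropy_ne_bot_iff {Ω E : Type*} [MeasurableSpace Ω] [MeasureSpace E]
    {X : Ω → E} {P : Measure Ω} : diffEntropy X P ≠ ⊥ ↔ entropyNegPart X P ≠ ⊤ := by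
  rw [diffEntropy, sub_eq_add_neg, ne_eq, EReal.add_eq_bot_iff, EReal.neg_eq_bot_iff,
    EReal.coe_ennreal_eq_top_iff]
  simp

theorem diffEntropy_eq_top {Ω E : Type*} [MeasurableSpace Ω] [MeasureSpace E]
    {X : Ω → E} {P : Measure Ω} (hp : entropyPosPart X P = ⊤) (hn : entropyNegPart X P ≠ ⊤) :
    diffEntropy X P = ⊤ := by
  lift entropyNegPart X P to NNReal using hn with a ha
  rw [diffEntropy, hp, ← ha]
  exact EReal.top_sub_coe a

/-- Here `q` is meant as the log-density pulled back to the Gaussian space, where all entropies are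
compared. -/
theorem diffEntropy_eq_neg_integral {Ω E Z : Type*} [MeasurableSpace Ω] [MeasureSpace E]
    [MeasurableSpace Z] {X : Ω → E} {P : Measure Ω} {γ : Measure Z} {q : Z → ℝ}
    (hq : Integrable q γ) (hp : entropyPosPart X P = ∫⁻ z, ENNReal.ofReal (-q z) ∂γ)
    (hn : entropyNegPart X P = ∫⁻ z, ENNReal.ofReal (q z) ∂γ) :
    diffEntropy X P = ((-∫ z, q z ∂γ : ℝ) : EReal) := by
  have h1 : ∫⁻ z, ENNReal.ofReal (q z) ∂γ ≠ ⊤ := hq.lintegral_lt_top.ne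
  have h2 : ∫⁻ z, ENNReal.ofReal (-q z) ∂γ ≠ ⊤ := hq.neg.lintegral_lt_top.ne
  rw [integral_eq_lintegral_pos_part_sub_lintegral_neg_part hq, neg_sub, diffEntropy, hp, hn,
    EReal.coe_sub, EReal.coe_ennreal_toReal h1, EReal.coe_ennreal_toReal h2]

theorem MeasureTheory.HasPDF.comp_measurableEquiv {Ω E F : Type*} [MeasurableSpace Ω]
    [MeasureSpace E] [MeasureSpace F] {X : Ω → E} {P : Measure Ω} [IsFiniteMeasure P]
    [SigmaFinite (volume : Measure F)] (hX : HasPDF X P volume) (e : E ≃ᵐ F)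
    (he : MeasurePreserving e) : HasPDF (fun ω => e (X ω)) P volume :=
  pdf.quasiMeasurePreserving_hasPDF' X he.quasiMeasurePreserving

theorem pdf_comp_measurableEquiv {Ω E F : Type*} [MeasurableSpace Ω] [MeasureSpace E]
    [MeasureSpace F] {X : Ω → E} {P : Measure Ω} [IsFiniteMeasure P]
    [SigmaFinite (volume : Measure E)] (hX : AEMeasurable X P) (e : E ≃ᵐ F)
    (he : MeasurePreserving e) :
    (fun x => pdf (fun ω => e (X ω)) P volume (e x)) =ᵐ[volume] pdf X P volume := by
  have h := e.measurableEmbedding.rnDeriv_map (P.map X) volume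
  rw [he.map_eq, AEMeasurable.map_map_of_aemeasurable e.measurable.aemeasurable hX] at h
  exact h

theorem entropyPosPart_comp_measurableEquiv {Ω E F : Type*} [MeasurableSpace Ω] [MeasureSpace E]
    [MeasureSpace F] {X : Ω → E} {P : Measure Ω} [IsFiniteMeasure P]
    [SigmaFinite (volume : Measure E)] (hX : AEMeasurable X P) (e : E ≃ᵐ F)
    (he : MeasurePreserving e) :
    entropyPosPart (fun ω => e (X ω)) P = entropyPosPart X P := by
  rw [entropyPosPart, ← he.map_eq, lintegral_map_equiv, he.map_eq]
  refine lintegral_congr_ae ?_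
  filter_upwards [pdf_comp_measurableEquiv hX e he] with x hx
  rw [hx]

theorem entropyNegPart_comp_measurableEquiv {Ω E F : Type*} [MeasurableSpace Ω] [MeasureSpace E]
    [MeasureSpace F] {X : Ω → E} {P : Measure Ω} [IsFiniteMeasure P]
    [SigmaFinite (volume : Measure E)] (hX : AEMeasurable X P) (e : E ≃ᵐ F)
    (he : MeasurePreserving e) :
    entropyNegPart (fun ω => e (X ω)) P = entropyNegPart X P := by
  rw [entropyNegPart, ← he.map_eq, lintegral_map_equiv, he.map_eq]
  refine lintegral_congr_ae ?_
  filter_upwards [pdf_comp_measurableEquiv hX e he] with x hx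
  rw [hx]

/-! ### Jensen's inequality with one-sided integrability. -/

theorem integrable_of_lintegral_ofReal_ne_top {Z : Type*} [MeasurableSpace Z] {γ : Measure Z}
    {f : Z → ℝ} (hf : Measurable f) (h1 : ∫⁻ z, ENNReal.ofReal (f z) ∂γ ≠ ⊤)
    (h2 : ∫⁻ z, ENNReal.ofReal (-f z) ∂γ ≠ ⊤) : Integrable f γ := by
  refine ⟨hf.aestronglyMeasurable, ?_⟩
  rw [hasFiniteIntegral_iff_norm]
  have : ∀ z, ENNReal.ofReal ‖f z‖ ≤ ENNReal.ofReal (f z) + ENNReal.ofReal (-f z) := fun z => by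
    rcases le_total 0 (f z) with h | h
    · rw [Real.norm_of_nonneg h]; exact le_self_add
    · rw [Real.norm_of_nonpos h]; exact le_add_self
  refine (lintegral_mono this).trans_lt ?_
  rw [lintegral_add_left hf.ennreal_ofReal]
  exact ENNReal.add_lt_top.2 ⟨h1.lt_top, h2.lt_top⟩

/-- Jensen's inequality for `exp`, with integrability extracted from one-sided bounds. -/
theorem integrable_and_integral_le_of_lintegral_exp_le_one {Z n : Type*} [MeasurableSpace Z]
    [Fintype n] {γ : Measure Z} [IsProbabilityMeasure γ] {q e : Z → ℝ} {p : n → Z → ℝ}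
    {c : n → ℝ} (hq : Measurable q) (hp : ∀ j, Measurable (p j)) (he : Integrable e γ)
    (he0 : ∫ z, e z ∂γ = 0) (hc : ∀ j, 0 ≤ c j)
    (hpos : ∀ j, c j ≠ 0 → ∫⁻ z, ENNReal.ofReal (p j z) ∂γ ≠ ⊤)
    (hexp : ∫⁻ z, ENNReal.ofReal (Real.exp (q z - ∑ j, c j * p j z + e z)) ∂γ ≤ 1) :
    ∫⁻ z, ENNReal.ofReal (q z) ∂γ ≠ ⊤ ∧
    (∫⁻ z, ENNReal.ofReal (-q z) ∂γ ≠ ⊤ → Integrable q γ ∧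
      (∀ j, c j ≠ 0 → Integrable (p j) γ) ∧ ∫ z, q z ∂γ ≤ ∑ j, c j * ∫ z, p j z ∂γ) := by
  set Y : Z → ℝ := fun z => q z - ∑ j, c j * p j z + e z with hY
  have hYm : AEMeasurable Y γ :=
    (hq.sub (Finset.measurable_sum _ fun j _ => (hp j).const_mul (c j))).aemeasurable.add
      he.aestronglyMeasurable.aemeasurable
  have hEi : Integrable (fun z => Real.exp (Y z)) γ := by
    refine ⟨(Real.measurable_exp.comp_aemeasurable hYm).aestronglyMeasurable, ?_⟩
    rw [hasFiniteIntegral_iff_ofReal (.of_forall fun z => (Real.exp_pos _).le)]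
    exact hexp.trans_lt ENNReal.one_lt_top
  have hE1 : ∫ z, Real.exp (Y z) ∂γ ≤ 1 := by
    rw [integral_eq_lintegral_of_nonneg_ae (.of_forall fun z => (Real.exp_pos _).le)
      hEi.aestronglyMeasurable]
    exact ENNReal.toReal_le_of_le_ofReal zero_le_one (by simpa using hexp)
  have hpp : ∀ j, Integrable (fun z => c j * max (p j z) 0) γ := fun j => by
    by_cases hj : c j = 0
    · simp [hj]
    refine Integrable.const_mul ?_ _
    refine integrable_of_lintegral_ofReal_ne_top ((hp j).max measurable_const) ?_ ?_
    · have : ∀ z, ENNReal.ofReal (max (p j z) 0) = ENNReal.ofReal (p j z) := fun z => by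
        rw [ENNReal.ofReal_max]; simp
      simpa [this] using hpos j hj
    · have : ∀ z, ENNReal.ofReal (-max (p j z) 0) = 0 := fun z =>
        ENNReal.ofReal_of_nonpos (by simp)
      simp [this]
  -- From `Y + 1 ≤ exp Y`, this integrable `B` dominates `q`, and even `q` plus the weighted
  -- negative part of any one `p j`. Hence integrability of `q` forces that of each `p j` with `c j
  -- ≠ 0`.
  set B : Z → ℝ := fun z => Real.exp (Y z) + ∑ j, c j * max (p j z) 0 + |e z| with hB
  have hBi : Integrable B γ :=
    (hEi.add (integrable_finsetSum _ fun j _ => hpp j)).add he.abs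
  have hqB : ∀ z j, q z + c j * max (-p j z) 0 ≤ B z := fun z j => by
    have h1 := Real.add_one_le_exp (Y z)
    have h2 : ∑ i, c i * p i z + c j * max (-p j z) 0 ≤ ∑ i, c i * max (p i z) 0 := by
      have : ∑ i, c i * max (p i z) 0 - ∑ i, c i * p i z = ∑ i, c i * max (-p i z) 0 := by
        rw [← Finset.sum_sub_distrib]
        refine Finset.sum_congr rfl fun i _ => ?_
        rw [← mul_sub]
        congr 1
        rcases le_total 0 (p i z) with h | h
        · rw [max_eq_left h, max_eq_right (by linarith)]; ring
        · rw [max_eq_right h, max_eq_left (by linarith)]; ring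
      have := Finset.single_le_sum (f := fun i => c i * max (-p i z) 0)
        (fun i _ => mul_nonneg (hc i) (le_max_right _ _)) (Finset.mem_univ j)
      linarith
    have h3 := neg_abs_le (e z)
    simp only [hB, hY] at h1 ⊢
    linarith
  have hqB' : ∀ z, q z ≤ B z := fun z => by
    have h1 := Real.add_one_le_exp (Y z)
    have h2 : ∑ i, c i * p i z ≤ ∑ i, c i * max (p i z) 0 :=
      Finset.sum_le_sum fun i _ => mul_le_mul_of_nonneg_left (le_max_left _ _) (hc i)
    have h3 := neg_abs_le (e z)
    simp only [hB, hY] at h1 ⊢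
    linarith
  have hqpos : ∫⁻ z, ENNReal.ofReal (q z) ∂γ ≠ ⊤ :=
    ((lintegral_mono fun z => ENNReal.ofReal_le_ofReal (hqB' z)).trans_lt
      hBi.lintegral_lt_top).ne
  refine ⟨hqpos, fun hqneg => ?_⟩
  have hqi : Integrable q γ := integrable_of_lintegral_ofReal_ne_top hq hqpos hqneg
  have hpi : ∀ j, c j ≠ 0 → Integrable (p j) γ := fun j hj => by
    refine integrable_of_lintegral_ofReal_ne_top (hp j) (hpos j hj) ?_
    have hcj : 0 < c j := lt_of_le_of_ne (hc j) hj.symm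
    refine ((lintegral_mono fun z => ENNReal.ofReal_le_ofReal (?_ : -p j z ≤
      (c j)⁻¹ * (B z - q z))).trans_lt ((hBi.sub hqi).const_mul _).lintegral_lt_top).ne
    rw [← div_eq_inv_mul, le_div_iff₀ hcj]
    have := hqB z j
    have h2 := mul_le_mul_of_nonneg_left (le_max_left (-p j z) 0) hcj.le
    linarith
  refine ⟨hqi, hpi, ?_⟩
  have hci : ∀ j, Integrable (fun z => c j * p j z) γ := fun j => by
    by_cases hj : c j = 0
    · simp [hj]
    · exact (hpi j hj).const_mul _
  have hsum : Integrable (fun z => ∑ j, c j * p j z) γ := integrable_finsetSum _ fun j _ => hci j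
  have hYint : ∫ z, Y z ∂γ = ∫ z, q z ∂γ - ∑ j, c j * ∫ z, p j z ∂γ := by
    have h1 : ∫ z, Y z ∂γ = ∫ z, (q z - ∑ j, c j * p j z) ∂γ + ∫ z, e z ∂γ :=
      integral_add (hqi.sub hsum) he
    rw [h1, integral_sub hqi hsum, integral_finsetSum _ fun j _ => hci j, he0, add_zero]
    simp_rw [integral_const_mul]
  -- The right side is at most 0 by `hE1`; this is Jensen in tangent-line form.
  have hle : ∫ z, Y z ∂γ ≤ ∫ z, (Real.exp (Y z) - 1) ∂γ :=
    integral_mono ((hqi.sub hsum).add he) (hEi.sub (integrable_const _)) fun z => by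
      have := Real.add_one_le_exp (Y z)
      simp only
      linarith
  rw [integral_sub hEi (integrable_const _), hYint] at hle
  simp at hle
  linarith

/-! ### The Gaussian correction term. -/

theorem ProbabilityTheory.measurePreserving_mulVec_pi_gaussianReal {m n : Type*} [Fintype m]
    [Fintype n] [DecidableEq m] {A : Matrix m n ℝ} (hA : A * A.transpose = 1) :
    MeasurePreserving (fun z : n → ℝ => A.mulVec z) (Measure.pi fun _ : n => gaussianReal 0 1)
      (Measure.pi fun _ : m => gaussianReal 0 1) := by
  have hm : Measurable fun z : n → ℝ => A.mulVec z := Continuous.measurable (by fun_prop)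
  refine ⟨hm, ?_⟩
  rw [← map_prod_pi_gaussianReal hA, Measure.map_map hm (Continuous.measurable (by fun_prop))]
  have : ((fun z : n → ℝ => A.mulVec z) ∘ fun p : (m → ℝ) × (n → ℝ) =>
      A.transpose.mulVec p.1 + (p.2 - A.transpose.mulVec (A.mulVec p.2))) = Prod.fst := by
    ext1 p
    simp only [Function.comp_apply]
    rw [Matrix.mulVec_add, Matrix.mulVec_sub, Matrix.mulVec_mulVec, hA,
      Matrix.mulVec_mulVec, hA, Matrix.one_mulVec, Matrix.one_mulVec, sub_self, add_zero]
  rw [this]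
  exact measurePreserving_fst.map_eq

theorem Matrix.sum_sq_col_ne_zero_iff {m n : Type*} [Fintype m] {A : Matrix m n ℝ} {j : n} :
    ∑ i, A i j ^ 2 ≠ 0 ↔ ∃ i, A i j ≠ 0 := by
  rw [ne_eq, Finset.sum_eq_zero_iff_of_nonneg fun i _ => sq_nonneg _]
  simp

/-- Each coordinate of `z` and of `Az` is standard Gaussian, and the weights `∑ i, A i j ^ 2` add up
over `j` to the number of rows, so the two means cancel. -/
theorem ProbabilityTheory.integrable_log_gaussianPDFReal_sub {m n : Type*} [Fintype m]
    [Fintype n] [DecidableEq m] {A : Matrix m n ℝ} (hA : A * A.transpose = 1) :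
    Integrable (fun z : n → ℝ => ∑ j, (∑ i, A i j ^ 2) * Real.log (gaussianPDFReal 0 1 (z j)) -
      ∑ i, Real.log (gaussianPDFReal 0 1 (A.mulVec z i)))
      (Measure.pi fun _ : n => gaussianReal 0 1) ∧
    ∫ z : n → ℝ, (∑ j, (∑ i, A i j ^ 2) * Real.log (gaussianPDFReal 0 1 (z j)) -
      ∑ i, Real.log (gaussianPDFReal 0 1 (A.mulVec z i)))
      ∂(Measure.pi fun _ : n => gaussianReal 0 1) = 0 := by
  have hev : ∀ j : n, MeasurePreserving (fun z : n → ℝ => z j)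
      (Measure.pi fun _ : n => gaussianReal 0 1) (gaussianReal 0 1) := fun j =>
    measurePreserving_eval _ j
  have hAev : ∀ i : m, MeasurePreserving (fun z : n → ℝ => A.mulVec z i)
      (Measure.pi fun _ : n => gaussianReal 0 1) (gaussianReal 0 1) := fun i =>
    (measurePreserving_eval (fun _ : m => gaussianReal 0 1) i).comp
      (measurePreserving_mulVec_pi_gaussianReal hA)
  have hl := integrable_log_gaussianPDFReal
  have h1 : ∀ j : n, Integrable (fun z : n → ℝ =>
      (∑ i, A i j ^ 2) * Real.log (gaussianPDFReal 0 1 (z j)))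
      (Measure.pi fun _ : n => gaussianReal 0 1) := fun j =>
    ((hev j).integrable_comp_of_integrable hl).const_mul _
  have h2 : ∀ i : m, Integrable (fun z : n → ℝ =>
      Real.log (gaussianPDFReal 0 1 (A.mulVec z i)))
      (Measure.pi fun _ : n => gaussianReal 0 1) := fun i =>
    (hAev i).integrable_comp_of_integrable hl
  refine ⟨(integrable_finsetSum _ fun j _ => h1 j).sub (integrable_finsetSum _ fun i _ => h2 i), ?_⟩
  rw [integral_sub (integrable_finsetSum _ fun j _ => h1 j)
    (integrable_finsetSum _ fun i _ => h2 i), integral_finsetSum _ fun j _ => h1 j,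
    integral_finsetSum _ fun i _ => h2 i]
  set E := ∫ x, Real.log (gaussianPDFReal 0 1 x) ∂(gaussianReal 0 1) with hE
  have e1 : ∀ j : n, ∫ z : n → ℝ, (∑ i, A i j ^ 2) * Real.log (gaussianPDFReal 0 1 (z j))
      ∂(Measure.pi fun _ : n => gaussianReal 0 1) = (∑ i, A i j ^ 2) * E := fun j => by
    have h := integral_map (hev j).aemeasurable
      (f := fun x => Real.log (gaussianPDFReal 0 1 x)) (by rw [(hev j).map_eq]; exact hl.1)
    rw [(hev j).map_eq] at h
    rw [integral_const_mul, hE, h]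
  have e2 : ∀ i : m, ∫ z : n → ℝ, Real.log (gaussianPDFReal 0 1 (A.mulVec z i))
      ∂(Measure.pi fun _ : n => gaussianReal 0 1) = E := fun i => by
    have h := integral_map (hAev i).aemeasurable
      (f := fun x => Real.log (gaussianPDFReal 0 1 x)) (by rw [(hAev i).map_eq]; exact hl.1)
    rw [(hAev i).map_eq] at h
    rw [hE, h]
  simp_rw [e1, e2]
  rw [← Finset.sum_mul, Finset.sum_comm]
  simp_rw [Matrix.sum_sq_row_of_mul_transpose_eq_one hA]
  simp

/-! ### The entropy inequality. -/

/-- The entropy inequality for linear images under matrices with orthonormal rows, with the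
existence of the density and finiteness of the negative part of the entropy. -/
theorem hasPDF_mulVec_and_entropy {Ω m n : Type*} [MeasurableSpace Ω] {P : Measure Ω}
    [IsProbabilityMeasure P] [Fintype m] [Fintype n] [DecidableEq m] [DecidableEq n]
    {X : n → Ω → ℝ} (hX : ∀ j, Measurable (X j)) (hind : iIndepFun X P)
    (hpdf : ∀ j, HasPDF (X j) P volume) {A : Matrix m n ℝ} (hA : A * A.transpose = 1) :
    HasPDF (fun ω => A.mulVec fun j => X j ω) P volume ∧
    ((∀ j, (∃ i, A i j ≠ 0) → entropyNegPart (X j) P ≠ ⊤) →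
      entropyNegPart (fun ω => A.mulVec fun j => X j ω) P ≠ ⊤ ∧
      (entropyPosPart (fun ω => A.mulVec fun j => X j ω) P ≠ ⊤ →
        ∃ (r : ℝ) (s : n → ℝ), diffEntropy (fun ω => A.mulVec fun j => X j ω) P = r ∧
          (∀ j, (∃ i, A i j ≠ 0) → diffEntropy (X j) P = s j) ∧
          ∑ j, (∑ i, A i j ^ 2) * s j ≤ r)) := by
  have hprob : ∀ j, IsProbabilityMeasure (P.map (X j)) := fun j =>
    Measure.isProbabilityMeasure_map (hX j).aemeasurable
  choose T hTmono hTmap hTae using fun j =>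
    exists_strictMono_map_gaussianReal (P.map (X j)) (hpdf j).absolutelyContinuous
  set γ : Measure (n → ℝ) := Measure.pi fun _ : n => gaussianReal 0 1 with hγ
  set Y : Ω → m → ℝ := fun ω => A.mulVec fun j => X j ω with hYdef
  have hAm : Measurable fun x : n → ℝ => A.mulVec x := Continuous.measurable (by fun_prop)
  have hYm : Measurable Y := hAm.comp (measurable_pi_lambda _ hX)
  have hTm : ∀ j, Measurable (T j) := fun j => (hTmono j).monotone.measurable
  set Θ : (n → ℝ) → m → ℝ := fun z => A.mulVec fun j => T j (z j) with hΘ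
  have hTpi : Measurable fun z : n → ℝ => fun j => T j (z j) :=
    measurable_pi_lambda _ fun j => (hTm j).comp (measurable_pi_apply j)
  have hΘm : Measurable Θ := hAm.comp hTpi
  have hlaw : P.map Y = γ.map Θ := by
    have h1 := (iIndepFun_iff_map_fun_eq_pi_map fun j => (hX j).aemeasurable).1 hind
    have h2 : γ.map (fun z j => T j (z j)) = Measure.pi fun j => P.map (X j) := by
      have : ∀ j, SigmaFinite ((gaussianReal 0 1).map (T j)) := fun j => by
        rw [hTmap]; infer_instance
      rw [hγ, Measure.pi_map_pi fun j => (hTm j).aemeasurable]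
      simp_rw [hTmap]
    calc P.map Y = (P.map fun ω j => X j ω).map fun x => A.mulVec x :=
          (Measure.map_map hAm (measurable_pi_lambda _ hX)).symm
      _ = (γ.map fun z j => T j (z j)).map fun x => A.mulVec x := by rw [h1, h2]
      _ = γ.map Θ := Measure.map_map hAm hTpi
  have hgood : ∀ᵐ z ∂γ, ∀ j, 0 < deriv (T j) (z j) ∧
      0 < (pdf (X j) P volume (T j (z j))).toReal ∧
      (pdf (X j) P volume (T j (z j))).toReal * deriv (T j) (z j) =
        gaussianPDFReal 0 1 (z j) :=
    ae_all_iff.2 fun j => (Measure.quasiMeasurePreserving_eval (fun _ : n => gaussianReal 0 1) j).ae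
      ((hTae j).mono fun z hz => hz.2)
  have hφ : ∀ z : n → ℝ, 0 < ∏ i, gaussianPDFReal 0 1 (A.mulVec z i) := fun z =>
    Finset.prod_pos fun i _ => gaussianPDFReal_pos 0 1 _ one_ne_zero
  have hbound {g : (m → ℝ) → ℝ≥0∞} (hg : Measurable g) :=
    lintegral_gaussian_det_div_le hA hTmono (fun j => (hTae j).mono fun z hz => hz.1) hg
  -- Testing `hbound` on the indicator of a null set: the weight is positive almost everywhere, so
  -- `Θ` almost surely avoids the set.
  have hac : P.map Y ≪ volume := by
    refine Measure.AbsolutelyContinuous.mk fun N hN hN0 => ?_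
    have h := hbound (measurable_const.indicator (f := fun _ => (1 : ℝ≥0∞)) hN)
    rw [lintegral_indicator_const hN, hN0, mul_zero, nonpos_iff_eq_zero] at h
    replace h := (lintegral_eq_zero_iff (((measurable_const.indicator hN).comp hΘm).mul
      (measurable_det_diagonal_deriv_div A T))).1 h
    rw [hlaw, Measure.map_apply hΘm hN, measure_eq_zero_iff_ae_notMem]
    filter_upwards [h, hgood] with z hz hgz hzN
    have hdet := (Matrix.sum_sq_mul_log_le_log_det hA fun j => (hgz j).1).1
    rw [Pi.mul_apply, Function.comp_apply, Set.indicator_of_mem (show Θ z ∈ N from hzN), one_mul,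
      Pi.zero_apply, ENNReal.ofReal_eq_zero, abs_of_pos hdet] at hz
    exact hz.not_gt (div_pos hdet (hφ z))
  have hYpdf : HasPDF Y P volume :=
    (hasPDF_iff_of_aemeasurable hYm.aemeasurable).2 ⟨inferInstance, hac⟩
  refine ⟨hYpdf, fun hneg => ?_⟩
  have hpm : ∀ j, Measurable fun z : n → ℝ =>
      Real.log (pdf (X j) P volume (T j (z j))).toReal := fun j =>
    Real.measurable_log.comp (((measurable_pdf (X j) P volume).comp
      ((hTm j).comp (measurable_pi_apply j))).ennreal_toReal)
  have hqm : Measurable fun z => Real.log (pdf Y P volume (Θ z)).toReal :=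
    Real.measurable_log.comp (((measurable_pdf Y P volume).comp hΘm).ennreal_toReal)
  have hYpos : entropyPosPart Y P =
      ∫⁻ z, ENNReal.ofReal (-Real.log (pdf Y P volume (Θ z)).toReal) ∂γ := by
    rw [entropyPosPart_eq_lintegral_map, hlaw, lintegral_map _ hΘm]
    have := measurable_pdf Y P volume
    fun_prop
  have hYneg : entropyNegPart Y P =
      ∫⁻ z, ENNReal.ofReal (Real.log (pdf Y P volume (Θ z)).toReal) ∂γ := by
    rw [entropyNegPart_eq_lintegral_map, hlaw, lintegral_map _ hΘm]
    have := measurable_pdf Y P volume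
    fun_prop
  have hXmap : ∀ j, P.map (X j) = γ.map fun z => T j (z j) := fun j => by
    rw [← hTmap, ← (measurePreserving_eval (fun _ : n => gaussianReal 0 1) j).map_eq,
      Measure.map_map (hTm j) (measurable_pi_apply j)]
    rfl
  have hXpos : ∀ j, entropyPosPart (X j) P =
      ∫⁻ z, ENNReal.ofReal (-Real.log (pdf (X j) P volume (T j (z j))).toReal) ∂γ := fun j => by
    rw [entropyPosPart_eq_lintegral_map, hXmap, lintegral_map]
    · have := measurable_pdf (X j) P volume
      fun_prop
    · exact (hTm j).comp (measurable_pi_apply j)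
  have hXneg : ∀ j, entropyNegPart (X j) P =
      ∫⁻ z, ENNReal.ofReal (Real.log (pdf (X j) P volume (T j (z j))).toReal) ∂γ := fun j => by
    rw [entropyNegPart_eq_lintegral_map, hXmap, lintegral_map]
    · have := measurable_pdf (X j) P volume
      fun_prop
    · exact (hTm j).comp (measurable_pi_apply j)
  obtain ⟨he, he0⟩ := integrable_log_gaussianPDFReal_sub hA
  have hYae : ∀ᵐ z ∂γ, 0 < pdf Y P volume (Θ z) ∧ pdf Y P volume (Θ z) < ⊤ := by
    refine ae_of_ae_map (p := fun y => 0 < pdf Y P volume y ∧ pdf Y P volume y < ⊤)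
      hΘm.aemeasurable ?_
    rw [← hlaw]
    exact (Measure.rnDeriv_pos hac).and (hac.ae_le (Measure.rnDeriv_lt_top _ _))
  -- Now `hbound` is tested on the density of `Y`, of total mass 1; `hkey` is the logarithm of the
  -- Jacobian equation, weighted and summed.
  have hexp : ∫⁻ z, ENNReal.ofReal (Real.exp (Real.log (pdf Y P volume (Θ z)).toReal -
      ∑ j, (∑ i, A i j ^ 2) * Real.log (pdf (X j) P volume (T j (z j))).toReal +
      (∑ j, (∑ i, A i j ^ 2) * Real.log (gaussianPDFReal 0 1 (z j)) -
        ∑ i, Real.log (gaussianPDFReal 0 1 (A.mulVec z i))))) ∂γ ≤ 1 := by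
    refine le_trans (lintegral_mono_ae ?_) ((hbound (measurable_pdf Y P volume)).trans
      (le_of_eq ?_))
    · filter_upwards [hgood, hYae] with z hz hYz
      obtain ⟨hdet, hlog⟩ := Matrix.sum_sq_mul_log_le_log_det hA
        (d := fun j => deriv (T j) (z j)) fun j => (hz j).1
      have hy : 0 < (pdf Y P volume (Θ z)).toReal := ENNReal.toReal_pos hYz.1.ne' hYz.2.ne
      rw [abs_of_pos hdet, ← ENNReal.ofReal_toReal hYz.2.ne, ← ENNReal.ofReal_mul hy.le,
        ENNReal.toReal_ofReal hy.le]
      refine ENNReal.ofReal_le_ofReal ?_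
      rw [← Real.le_log_iff_exp_le (mul_pos hy (div_pos hdet (hφ z))),
        Real.log_mul hy.ne' (div_pos hdet (hφ z)).ne', Real.log_div hdet.ne' (hφ z).ne',
        Real.log_prod fun i _ => (gaussianPDFReal_pos 0 1 _ one_ne_zero).ne']
      have hkey : ∑ j, (∑ i, A i j ^ 2) * Real.log (gaussianPDFReal 0 1 (z j)) -
          ∑ j, (∑ i, A i j ^ 2) * Real.log (pdf (X j) P volume (T j (z j))).toReal =
          ∑ i, ∑ j, A i j ^ 2 * Real.log (deriv (T j) (z j)) := by
        rw [← Finset.sum_sub_distrib, Finset.sum_comm]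
        refine Finset.sum_congr rfl fun j _ => ?_
        rw [← (hz j).2.2, Real.log_mul (hz j).2.1.ne' (hz j).1.ne', ← Finset.sum_mul]
        ring
      linarith
    · rw [pdf.lintegral_eq_measure_univ]; simp
  obtain ⟨hfin, hmain⟩ := integrable_and_integral_le_of_lintegral_exp_le_one (γ := γ)
    (c := fun j => ∑ i, A i j ^ 2) hqm hpm he he0
    (fun j => Finset.sum_nonneg fun i _ => sq_nonneg _)
    (fun j hj => by rw [← hXneg]; exact hneg j (Matrix.sum_sq_col_ne_zero_iff.1 hj)) hexp
  refine ⟨by rwa [hYneg], fun hpos => ?_⟩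
  rw [hYpos] at hpos
  obtain ⟨hqi, hpi, hle⟩ := hmain hpos
  refine ⟨_, fun j => -∫ z, Real.log (pdf (X j) P volume (T j (z j))).toReal ∂γ,
    diffEntropy_eq_neg_integral hqi hYpos hYneg, fun j hj => ?_, ?_⟩
  · exact diffEntropy_eq_neg_integral (hpi j (Matrix.sum_sq_col_ne_zero_iff.2 hj)) (hXpos j)
      (hXneg j)
  · simp only [mul_neg, Finset.sum_neg_distrib]
    linarith

theorem EReal.sum_eq_bot_of_mem {ι : Type*} {s : Finset ι} {f : ι → EReal} {i : ι} (hi : i ∈ s)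
    (h : f i = ⊥) : ∑ j ∈ s, f j = ⊥ := by
  classical
  rw [← Finset.add_sum_erase s f hi, h, EReal.bot_add]

theorem EReal.coe_finset_sum {ι : Type*} (s : Finset ι) (f : ι → ℝ) :
    ((∑ i ∈ s, f i : ℝ) : EReal) = ∑ i ∈ s, (f i : EReal) := by
  classical
  induction s using Finset.induction_on with
  | empty => simp
  | insert a s ha ih => rw [Finset.sum_insert ha, Finset.sum_insert ha, EReal.coe_add, ih]

/-- The entropy inequality for linear images under matrices with orthonormal rows. -/
theorem sum_sq_mul_diffEntropy_le_diffEntropy_mulVec {Ω m n : Type*} [MeasurableSpace Ω]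
    {P : Measure Ω} [IsProbabilityMeasure P] [Fintype m] [Fintype n] [DecidableEq m]
    [DecidableEq n] {X : n → Ω → ℝ} (hX : ∀ j, Measurable (X j)) (hind : iIndepFun X P)
    (hpdf : ∀ j, HasPDF (X j) P volume) {A : Matrix m n ℝ} (hA : A * A.transpose = 1) :
    HasPDF (fun ω => A.mulVec (fun j => X j ω)) P volume ∧
      ((∀ j, (∃ i, A i j ≠ 0) → diffEntropy (X j) P ≠ ⊥) →
        HasDiffEntropy (fun ω => A.mulVec (fun j => X j ω)) P) ∧
      ∑ i, ∑ j, (((A i j) ^ 2 : ℝ) : EReal) * diffEntropy (X j) P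
          ≤ diffEntropy (fun ω => A.mulVec (fun j => X j ω)) P := by
  obtain ⟨hY, hmain⟩ := hasPDF_mulVec_and_entropy hX hind hpdf hA
  simp only [← diffEntropy_ne_bot_iff] at hmain
  refine ⟨hY, fun h => ⟨hY, .inr (diffEntropy_ne_bot_iff.1 (hmain h).1)⟩, ?_⟩
  by_cases h : ∀ j, (∃ i, A i j ≠ 0) → diffEntropy (X j) P ≠ ⊥
  · obtain ⟨hneg, hfin⟩ := hmain h
    by_cases hpos : entropyPosPart (fun ω => A.mulVec fun j => X j ω) P = ⊤
    · rw [diffEntropy_eq_top hpos (diffEntropy_ne_bot_iff.1 hneg)]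
      exact le_top
    · obtain ⟨r, s, hr, hs, hle⟩ := hfin hpos
      have hterm : ∀ i j, (((A i j) ^ 2 : ℝ) : EReal) * diffEntropy (X j) P =
          ((A i j ^ 2 * s j : ℝ) : EReal) := fun i j => by
        by_cases hij : A i j = 0
        · simp [hij]
        · rw [hs j ⟨i, hij⟩, EReal.coe_mul]
      simp_rw [hr, hterm, ← EReal.coe_finset_sum]
      rw [EReal.coe_le_coe_iff, Finset.sum_comm]
      simpa only [← Finset.sum_mul] using hle
  -- A nonzero coefficient meets an entropy `⊥`; in `EReal` this makes the whole sum `⊥`, even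
  -- beside `⊤`.
  · push Not at h
    obtain ⟨j, ⟨i, hij⟩, hj⟩ := h
    refine le_of_eq_of_le ?_ bot_le
    refine EReal.sum_eq_bot_of_mem (Finset.mem_univ i)
      (EReal.sum_eq_bot_of_mem (Finset.mem_univ j) ?_)
    rw [hj]
    exact EReal.coe_mul_bot_of_pos (by positivity)

theorem mainTheorem7 {Ω : Type*} [MeasurableSpace Ω] (P : Measure Ω) [IsProbabilityMeasure P]
    (n : ℕ) (X : Fin n → Ω → ℝ) (hX : ∀ j, Measurable (X j)) (hind : iIndepFun X P)
    (hent : ∀ j, HasDiffEntropy (X j) P) :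
    (∀ (m : ℕ) (A : Matrix (Fin m) (Fin n) ℝ), A * A.transpose = 1 →
      HasPDF (fun ω => A.mulVec (fun j => X j ω)) P volume ∧
      ((∀ j, (∃ i, A i j ≠ 0) → diffEntropy (X j) P ≠ ⊥) →
        HasDiffEntropy (fun ω => A.mulVec (fun j => X j ω)) P) ∧
      (HasDiffEntropy (fun ω => A.mulVec (fun j => X j ω)) P →
        ∑ i, ∑ j, (((A i j) ^ 2 : ℝ) : EReal) * diffEntropy (X j) P
          ≤ diffEntropy (fun ω => A.mulVec (fun j => X j ω)) P)) ∧
    (∀ a : Fin n → ℝ, ∑ i, a i ^ 2 = 1 →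
      HasPDF (fun ω => ∑ i, a i * X i ω) P volume ∧
      ((∀ i, a i ≠ 0 → diffEntropy (X i) P ≠ ⊥) →
        HasDiffEntropy (fun ω => ∑ i, a i * X i ω) P) ∧
      (HasDiffEntropy (fun ω => ∑ i, a i * X i ω) P →
        ∑ i, ((a i ^ 2 : ℝ) : EReal) * diffEntropy (X i) P
          ≤ diffEntropy (fun ω => ∑ i, a i * X i ω) P)) := by
  have hpdf : ∀ j, HasPDF (X j) P volume := fun j => (hent j).1
  refine ⟨fun m A hA => ?_, fun a ha => ?_⟩
  · obtain ⟨h1, h2, h3⟩ := sum_sq_mul_diffEntropy_le_diffEntropy_mulVec hX hind hpdf hA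
    exact ⟨h1, h2, fun _ => h3⟩
  -- A unit vector is a one-row matrix with orthonormal rows; `funUnique` identifies `Unit → ℝ` with
  -- `ℝ` preserving volume, hence entropy.
  · set A : Matrix Unit (Fin n) ℝ := Matrix.of fun _ j => a j with hAdef
    have hA : A * A.transpose = 1 := by
      ext i j
      simpa [Matrix.mul_apply, hAdef, sq] using ha
    obtain ⟨h1, h2, h3⟩ := sum_sq_mul_diffEntropy_le_diffEntropy_mulVec hX hind hpdf hA
    have he := volume_preserving_funUnique Unit ℝ
    have hm : AEMeasurable (fun ω => A.mulVec fun j => X j ω) P := h1.aemeasurable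
    have hfun : (fun ω => ∑ i, a i * X i ω) =
        fun ω => MeasurableEquiv.funUnique Unit ℝ (A.mulVec fun j => X j ω) := by
      ext ω
      simp [hAdef, Matrix.mulVec, dotProduct]
    have hp := entropyPosPart_comp_measurableEquiv hm (MeasurableEquiv.funUnique Unit ℝ) he
    have hn := entropyNegPart_comp_measurableEquiv hm (MeasurableEquiv.funUnique Unit ℝ) he
    have hpdf' := h1.comp_measurableEquiv (MeasurableEquiv.funUnique Unit ℝ) he
    rw [hfun]
    refine ⟨hpdf', fun h => ⟨hpdf', ?_⟩, fun _ => ?_⟩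
    · rw [hp, hn]
      exact (h2 fun j ⟨_, hj⟩ => h j hj).2
    · rw [diffEntropy, hp, hn]
      simpa [hAdef, diffEntropy] using h3
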